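/- **Theorem (Lee Hwa Chung, degrees 1 and 2, and the characterization of canonical transformations).** All manifolds are real, finite-dimensional, Hausdorff, second-countable and $C^\infty$, without boundary, and all forms, vector fields and diffeomorphisms are $C^\infty$. A symplectic manifold $(M,\Omega)$ is a manifold $M$ with a closed $2$-form $\Omega$ that is nondegenerate at every point. A vector field $X$ on $M$ is *locally Hamiltonian* if the $1$-form $i(X)\Omega$ is closed; $\mathfrak X_{lh}(M)$ is the set of these vector fields. 1. Let $(M,\Omega)$ be a symplectic manifold and $\alpha$ a $1$-form on $M$ with $\mathrm L(X)\alpha=0$ for every $X\in\mathfrak X_{lh}(M)$. Then $\alpha=0$. 2. Let $(M,\Omega)$ be a connected symplectic manifold and $\alpha$ a $2$-form on $M$ with $\mathrm L(X)\alpha=0$ for every $X\in\mathfrak X_{lh}(M)$. Then $\alpha=c\,\Omega$ for some constant $c\in\mathbb R$. 3. Let $(M_1,\Omega_1)$ and $(M_2,\Omega_2)$ be symplectic manifolds with $M_1$ connected, and let $\Phi\colon M_1\to M_2$ be a diffeomorphism. Then $\Phi$ is a canonical transformation, that is, $\Phi_*(\mathfrak X_{lh}(M_1))=\mathfrak X_{lh}(M_2)$,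 if and only if $\Phi^*\Omega_2=c\,\Omega_1$ for some constant $c\in\mathbb R$. The implication from $\Phi^*\Omega_2=c\,\Omega_1$ to $\Phi$ being canonical holds also when $M_1$ is not connected. -/

import Mathlib

open scoped Manifold ContDiff

noncomputable section

namespace SymplecticGeometry

variable {E : Type*} [NormedAddCommGroup E] [NormedSpace ℝ E]
  {M : Type*} [TopologicalSpace M] [ChartedSpace E M]
  {E' : Type*} [NormedAddCommGroup E'] [NormedSpace ℝ E']
  {M' : Type*} [TopologicalSpace M'] [ChartedSpace E' M']

/-- A (not necessarily smooth) vector field on `M`. -/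
abbrev VField (E : Type*) [NormedAddCommGroup E] [NormedSpace ℝ E]
    (M : Type*) [TopologicalSpace M] [ChartedSpace E M] : Type _ :=
  Π x : M, TangentSpace 𝓘(ℝ, E) x

/-- A (not necessarily smooth) differential form of degree `k` on `M`. -/
abbrev DForm (E : Type*) [NormedAddCommGroup E] [NormedSpace ℝ E]
    (M : Type*) [TopologicalSpace M] [ChartedSpace E M] (k : ℕ) : Type _ :=
  Π x : M, (TangentSpace 𝓘(ℝ, E) x) [⋀^Fin k]→L[ℝ] ℝ

/-- The expression of the form `α` in the preferred chart `φ` at `x₀`, that is, the pullback of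
`α` by `φ⁻¹`. It is meaningful on the (open) target of `φ`. -/
def DForm.inChart {k : ℕ} (α : DForm E M k) (x₀ : M) : E → E [⋀^Fin k]→L[ℝ] ℝ :=
  fun y ↦ (α ((extChartAt 𝓘(ℝ, E) x₀).symm y)).compContinuousLinearMap
    (mfderiv 𝓘(ℝ, E) 𝓘(ℝ, E) (extChartAt 𝓘(ℝ, E) x₀).symm y)

/-- The expression of the vector field `X` in the preferred chart at `x₀`. It is meaningful on
the (open) target of that chart. -/
def VField.inChart (X : VField E M) (x₀ : M) : E → E :=
  VectorField.mpullback 𝓘(ℝ, E) 𝓘(ℝ, E) (extChartAt 𝓘(ℝ, E) x₀).symm X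

/-- The alternating form on `T_x M` that has the expression `a` in the preferred chart at `x`. -/
def ofChartAt {k : ℕ} (x : M) (a : E [⋀^Fin k]→L[ℝ] ℝ) :
    (TangentSpace 𝓘(ℝ, E) x) [⋀^Fin k]→L[ℝ] ℝ :=
  a.compContinuousLinearMap (mfderiv 𝓘(ℝ, E) 𝓘(ℝ, E) (extChartAt 𝓘(ℝ, E) x) x)

/-- Smooth (`C^∞`) vector fields: smooth sections of the tangent bundle. -/
def VField.IsSmooth [IsManifold 𝓘(ℝ, E) ∞ M] (X : VField E M) : Prop :=
  ContMDiff 𝓘(ℝ, E) 𝓘(ℝ, E).tangent ∞ (fun x ↦ (X x : TangentBundle 𝓘(ℝ, E) M))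

/-- Smooth (`C^∞`) differential forms: the expression in every chart is smooth. -/
def DForm.IsSmooth {k : ℕ} (α : DForm E M k) : Prop :=
  ∀ x₀ : M, ContDiffOn ℝ ∞ (α.inChart x₀) (extChartAt 𝓘(ℝ, E) x₀).target

/-- The exterior differential `d α`, computed at `x` in the preferred chart at `x`. -/
def DForm.d {k : ℕ} (α : DForm E M k) : DForm E M (k + 1) :=
  fun x ↦ ofChartAt x (extDeriv (α.inChart x) (extChartAt 𝓘(ℝ, E) x x))

/-- The contraction `i(X) α = α(X, ·, …, ·)`. -/
def contraction {k : ℕ} (X : VField E M) (α : DForm E M (k + 1)) : DForm E M k :=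
  fun x ↦ ContinuousAlternatingMap.curryLeft (E := E) (α x) (X x)

/-- The Lie derivative, at the point `y`, of a form `a` along a vector field `V` of the vector
space `E`, i.e. the derivative at `t = 0` of the pullback of `a` by the flow of `V`:
`(L_V a)_y (v₁, …, v_k) = (D a (y) (V y)) (v₁, …, v_k) + ∑ i, a_y (v₁, …, D V (y) vᵢ, …, v_k)`. -/
def lieDerivVec {k : ℕ} (V : E → E) (a : E → E [⋀^Fin k]→L[ℝ] ℝ) (y : E) :
    E [⋀^Fin k]→L[ℝ] ℝ :=
  fderiv ℝ a y (V y) +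
    (a y).fderivCompContinuousLinearMap (ContinuousLinearMap.id ℝ E) (fderiv ℝ V y)

/-- The Lie derivative `L(X) α`, computed at `x` in the preferred chart at `x`. -/
def lieDeriv {k : ℕ} (X : VField E M) (α : DForm E M k) : DForm E M k :=
  fun x ↦ ofChartAt x
    (lieDerivVec (VField.inChart X x) (α.inChart x) (extChartAt 𝓘(ℝ, E) x x))

/-- The pullback `Φ^* α`. -/
def DForm.pullback {k : ℕ} (Φ : M → M') (α : DForm E' M' k) : DForm E M k :=
  fun x ↦ (α (Φ x)).compContinuousLinearMap (mfderiv 𝓘(ℝ, E) 𝓘(ℝ, E') Φ x)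

/-- The pushforward `Φ_* X` of a vector field by a diffeomorphism, i.e. the pullback by the
inverse diffeomorphism: `(Φ_* X)(y) = (D(Φ⁻¹)(y))⁻¹ (X (Φ⁻¹ y)) = DΦ (Φ⁻¹ y) (X (Φ⁻¹ y))`. -/
def VField.pushforward (Φ : M ≃ₘ⟮𝓘(ℝ, E), 𝓘(ℝ, E')⟯ M') (X : VField E M) : VField E' M' :=
  VectorField.mpullback 𝓘(ℝ, E') 𝓘(ℝ, E) Φ.symm X

/-- Symplectic forms: smooth, closed and nondegenerate `2`-forms. -/
structure IsSymplectic (Ω : DForm E M 2) : Prop where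
  smooth : Ω.IsSmooth
  closed : Ω.d = 0
  nondegenerate : ∀ (x : M) (v : TangentSpace 𝓘(ℝ, E) x),
    (∀ w : TangentSpace 𝓘(ℝ, E) x, Ω x ![v, w] = 0) → v = 0

/-- The set of locally Hamiltonian vector fields: the smooth vector fields `X` such that the
`1`-form `i(X) Ω` is closed. -/
def locallyHamiltonian [IsManifold 𝓘(ℝ, E) ∞ M] (Ω : DForm E M 2) : Set (VField E M) :=
  {X | VField.IsSmooth X ∧ (contraction X Ω).d = 0}

/-- `α` is an absolute invariant form for every locally Hamiltonian vector field of `Ω`. -/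
def IsLHInvariant [IsManifold 𝓘(ℝ, E) ∞ M] (Ω : DForm E M 2) {k : ℕ} (α : DForm E M k) : Prop :=
  ∀ X ∈ locallyHamiltonian Ω, lieDeriv X α = 0

/-- Canonical transformations: diffeomorphisms `Φ` with `Φ_*(𝔛_lh(M)) = 𝔛_lh(M')`. -/
def IsCanonical [IsManifold 𝓘(ℝ, E) ∞ M] [IsManifold 𝓘(ℝ, E') ∞ M']
    (Ω : DForm E M 2) (Ω' : DForm E' M' 2) (Φ : M ≃ₘ⟮𝓘(ℝ, E), 𝓘(ℝ, E')⟯ M') : Prop :=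
  VField.pushforward Φ '' locallyHamiltonian Ω = locallyHamiltonian Ω'

end SymplecticGeometry

end

/-!
# Invariant forms of the locally Hamiltonian vector fields

The proof works at one point `x` at a time, in the preferred chart at `x`, whose derivative at `x`
is the identity; the tensors `d α` and `L(X) α` at `x` are then literally the vector-space
expressions at the base point (`DForm.d_apply`, `lieDeriv_apply`).

There are enough locally Hamiltonian fields to prescribe a 1-jet: given a smooth function on the
model space, a bump function extends it from a neighbourhood of `x` to `M`, and the Hamiltonian
field of the extension is globally defined and locally Hamiltonian (`exists_locallyHamiltonian`).
A quadratic function `½ Ω(u, · - x)²` gives a field `X` vanishing at `x` with linear part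
`v ↦ Ω(u, v) u`, a rank one element of the symplectic Lie algebra
(`exists_locallyHamiltonian_fderiv_inChart_eq`). Where `X` vanishes, `L(X) α` only involves the
linear part of `X`, so invariance becomes linear algebra at `x`:

* for a `1`-form, `Ω(u, v) α(u) = 0` for all `u, v`, hence `α(u) = 0`;
* for a `2`-form, `Ω(u, v) α(u, w) + Ω(u, w) α(v, u) = 0`, hence every vector is an eigenvector of
  the endomorphism relating `α` to `Ω`, which is therefore a homothety and `α = c(x) Ω`
  (`exists_eq_smul_of_rankOne_invariant`).

In degree `2`, Cartan's formula (`lieDerivVec_eq_cartan`) gives `L(X) Ω = 0`, so that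
`0 = L(X) (c Ω) = (X c) Ω`. Linear functions produce fields with any prescribed value at `x`, so
`dc = 0` and `c` is locally constant.

For the canonical transformations, put `α = Φ^* Ω₂`. If `Φ` is canonical and `X` is locally
Hamiltonian, then `i(X) α = Φ^* (i(Φ_* X) Ω₂)` and `α` are closed because `d` commutes with pullback
(`DForm.d_pullback`), so `L(X) α = 0` by Cartan's formula and the result in degree `2` applies. It
is stated for forms that are only differentiable in the chart at each point, which spares a proof
that the pullback of a smooth form is smooth. Conversely, `Φ^* Ω₂ = c Ω₁` gives
`Φ^* (i(Φ_* X) Ω₂) = c i(X) Ω₁`, and the same argument applies to `Φ⁻¹`; the value `c = 0` forces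
the tangent spaces to vanish.
-/

namespace SymplecticGeometry

open ContinuousAlternatingMap Filter Set
open scoped Topology

/-! ### Cartan's formula and nondegenerate forms on a vector space -/

section VectorSpace

variable {V : Type*} [NormedAddCommGroup V] [NormedSpace ℝ V]

theorem contDiffAt_curryLeft {k : ℕ} {a : V → V [⋀^Fin (k + 1)]→L[ℝ] ℝ} {y : V}
    (ha : ContDiffAt ℝ ∞ a y) : ContDiffAt ℝ ∞ (fun z ↦ curryLeft (a z)) y :=
  ContDiffAt.comp (g := (curryLeftLI (𝕜 := ℝ) (E := V) (F := ℝ) (n := k)).toContinuousLinearMap)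
    y (ContinuousLinearMap.contDiff _).contDiffAt ha

theorem hasFDerivAt_curryLeft {k : ℕ} {a : V → V [⋀^Fin (k + 1)]→L[ℝ] ℝ} {X : V → V} {y : V}
    {a' : V →L[ℝ] V [⋀^Fin (k + 1)]→L[ℝ] ℝ} {X' : V →L[ℝ] V}
    (ha : HasFDerivAt a a' y) (hX : HasFDerivAt X X' y) :
    HasFDerivAt (fun z ↦ curryLeft (a z) (X z))
      ((curryLeft (a y)).comp X' +
        ((curryLeftLI (𝕜 := ℝ) (E := V) (F := ℝ) (n := k)).toContinuousLinearMap.comp a').flip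
          (X y)) y :=
  HasFDerivAt.clm_apply
    (HasFDerivAt.comp (g := (curryLeftLI (𝕜 := ℝ) (E := V) (F := ℝ) (n := k)).toContinuousLinearMap)
      y (ContinuousLinearMap.hasFDerivAt _) ha) hX

/-- Cartan's formula `L(X) a = d i(X) a + i(X) d a` on a vector space, for forms of positive
degree. -/
theorem lieDerivVec_eq_cartan {k : ℕ} {a : V → V [⋀^Fin (k + 1)]→L[ℝ] ℝ} {X : V → V} {y : V}
    (ha : DifferentiableAt ℝ a y) (hX : DifferentiableAt ℝ X y) :
    lieDerivVec X a y =
      extDeriv (fun z ↦ curryLeft (a z) (X z)) y + curryLeft (extDeriv a y) (X y) := by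
  rw [lieDerivVec, fderivCompContinuousLinearMap_eq_alternatizeUncurryFin, extDeriv, extDeriv,
    (hasFDerivAt_curryLeft ha.hasFDerivAt hX.hasFDerivAt).fderiv]
  ext v
  have hv (i : Fin (k + 1)) : i.succ.removeNth (Matrix.vecCons (X y) v) =
      Matrix.vecCons (X y) (i.removeNth v) := by
    ext j
    refine Fin.cases ?_ (fun j ↦ ?_) j <;> simp [Fin.removeNth_apply]
  simp [alternatizeUncurryFin_apply, Fin.sum_univ_succ (n := k + 1), pow_succ,
    curryLeft_apply_apply, hv]
  ring

theorem apply_eq_curryLeft (a : V [⋀^Fin 2]→L[ℝ] ℝ) (u v : V) :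
    a ![u, v] = curryLeft a u ![v] := rfl

theorem apply_swap (a : V [⋀^Fin 2]→L[ℝ] ℝ) (u v : V) : a ![u, v] = - a ![v, u] := by
  have := a.toAlternatingMap.map_swap ![v, u] (i := 0) (j := 1) (by simp)
  have e : (![v, u] ∘ Equiv.swap (0 : Fin 2) 1) = ![u, v] := by
    ext i; fin_cases i <;> simp
  rw [e] at this
  exact this

variable [FiniteDimensional ℝ V]

/-- A nondegenerate bilinear form on a finite-dimensional space identifies vectors with
`1`-forms. -/
theorem isInvertible_curryLeft {a : V [⋀^Fin 2]→L[ℝ] ℝ}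
    (ha : ∀ u, (∀ v, a ![u, v] = 0) → u = 0) : (curryLeft a).IsInvertible := by
  let e := (ofSubsingletonLIE (𝕜 := ℝ) (E := V) (F := ℝ) (0 : Fin 1)).toLinearEquiv.symm
  let f : V →ₗ[ℝ] (V →L[ℝ] ℝ) := e.toLinearMap ∘ₗ (curryLeft a).toLinearMap
  have hf : Function.Injective f := by
    rw [injective_iff_map_eq_zero]
    intro u hu
    have hu' : curryLeft a u = 0 := e.map_eq_zero_iff.1 hu
    refine ha u fun v ↦ ?_
    rw [apply_eq_curryLeft, hu']; rfl
  have hd : Module.finrank ℝ V = Module.finrank ℝ (V →L[ℝ] ℝ) := by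
    rw [← LinearMap.toContinuousLinearMap.finrank_eq, ← Subspace.dual_finrank_eq]
  let g := (LinearEquiv.ofInjectiveOfFinrankEq f hf hd).trans e.symm
  have : FiniteDimensional ℝ (V [⋀^Fin 1]→L[ℝ] ℝ) := Module.Finite.equiv e.symm
  refine ⟨g.toContinuousLinearEquiv, ?_⟩
  ext1 u
  change e.symm (e (curryLeft a u)) = _
  simp

/-- The hypothesis `h` says that `b` is infinitesimally invariant under the maps
`v ↦ a(u, v) u`, which span the symplectic Lie algebra of `a`; such a `b` is a multiple of `a`. -/
theorem exists_eq_smul_of_rankOne_invariant {a b : V [⋀^Fin 2]→L[ℝ] ℝ}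
    (ha : ∀ u, (∀ v, a ![u, v] = 0) → u = 0)
    (h : ∀ u v w, a ![u, v] * b ![u, w] + a ![u, w] * b ![v, u] = 0) :
    ∃ c : ℝ, b = c • a := by
  obtain ⟨e, he⟩ := isInvertible_curryLeft ha
  -- `B` is the endomorphism with `a(B u, w) = b(u, w)`; every `u` is an eigenvector of it.
  let B : V →ₗ[ℝ] V := (e.symm : _ →L[ℝ] V).toLinearMap ∘ₗ (curryLeft b).toLinearMap
  have hB : ∀ u, curryLeft a (B u) = curryLeft b u := fun u ↦ by
    rw [← he]; exact e.apply_symm_apply _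
  obtain ⟨c, hc⟩ := LinearMap.exists_eq_smul_id_of_forall_notLinearIndependent (f := B) (by
    intro u hu
    have hu0 : u ≠ 0 := hu.ne_zero 0
    obtain ⟨v, hv⟩ : ∃ v, a ![u, v] ≠ 0 := by
      by_contra! hcon
      exact hu0 (ha u hcon)
    have key : (-b ![u, v]) • u + a ![u, v] • B u = 0 := by
      have : curryLeft a ((-b ![u, v]) • u + a ![u, v] • B u) = 0 := by
        rw [map_add, map_smul, map_smul, hB]
        ext w
        have hw : w = ![w 0] := by ext i; fin_cases i; rfl
        rw [hw]
        have h1 := h u v (w 0)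
        rw [apply_swap b v u] at h1
        change -b ![u, v] * a ![u, w 0] + a ![u, v] * b ![u, w 0] = 0
        linarith
      rw [← he] at this
      exact e.map_eq_zero_iff.1 this
    exact hv (LinearIndependent.pair_iff.1 hu _ _ key).2)
  refine ⟨c, ?_⟩
  ext w
  have hw : w = ![w 0, w 1] := by ext i; fin_cases i <;> rfl
  rw [hw, apply_eq_curryLeft, ← hB, hc]
  simp [curryLeft_apply_apply]

end VectorSpace

/-! ### Lie derivatives along fields with a zero of rank one, and Leibniz rule -/

section LieDerivative

variable {V : Type*} [NormedAddCommGroup V] [NormedSpace ℝ V]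

theorem lieDerivVec_apply_one {X : V → V} {a : V → V [⋀^Fin 1]→L[ℝ] ℝ} {ℓ : V → ℝ} {y u : V}
    (hX : X y = 0) (hX' : ∀ v, fderiv ℝ X y v = ℓ v • u) (v : V) :
    lieDerivVec X a y ![v] = ℓ v * a y ![u] := by
  have h : (fun i ↦ (Function.update (fun _ : Fin 1 ↦ ContinuousLinearMap.id ℝ V) 0
      (fderiv ℝ X y) i) (![v] i)) = Function.update ![u] 0 (ℓ v • u) := by
    ext i
    fin_cases i
    simp [hX']
  rw [lieDerivVec, hX, _root_.map_zero, zero_add, fderivCompContinuousLinearMap_apply,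
    Fin.sum_univ_one, h, map_update_smul,
    show Function.update ![u] 0 u = ![u] from Function.update_eq_self 0 ![u], smul_eq_mul]

theorem lieDerivVec_apply_two {X : V → V} {a : V → V [⋀^Fin 2]→L[ℝ] ℝ} {ℓ : V → ℝ} {y u : V}
    (hX : X y = 0) (hX' : ∀ v, fderiv ℝ X y v = ℓ v • u) (v w : V) :
    lieDerivVec X a y ![v, w] = ℓ v * a y ![u, w] + ℓ w * a y ![v, u] := by
  have h0 : (fun i ↦ (Function.update (fun _ : Fin 2 ↦ ContinuousLinearMap.id ℝ V) 0
      (fderiv ℝ X y) i) (![v, w] i)) = Function.update ![u, w] 0 (ℓ v • u) := by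
    ext i
    fin_cases i <;> simp [hX']
  have h1 : (fun i ↦ (Function.update (fun _ : Fin 2 ↦ ContinuousLinearMap.id ℝ V) 1
      (fderiv ℝ X y) i) (![v, w] i)) = Function.update ![v, u] 1 (ℓ w • u) := by
    ext i
    fin_cases i <;> simp [hX']
  rw [lieDerivVec, hX, _root_.map_zero, zero_add, fderivCompContinuousLinearMap_apply,
    Fin.sum_univ_two, h0, h1, map_update_smul, map_update_smul,
    show Function.update ![u, w] 0 u = ![u, w] from Function.update_eq_self 0 ![u, w],
    show Function.update ![v, u] 1 u = ![v, u] from Function.update_eq_self 1 ![v, u],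
    smul_eq_mul, smul_eq_mul]

/-- Leibniz rule `L(X) (g a) = (X g) a + g L(X) a`. -/
theorem lieDerivVec_smul {k : ℕ} {X : V → V} {a : V → V [⋀^Fin k]→L[ℝ] ℝ} {g : V → ℝ} {y : V}
    (ha : DifferentiableAt ℝ a y) (hg : DifferentiableAt ℝ g y) :
    lieDerivVec X (fun z ↦ g z • a z) y = fderiv ℝ g y (X y) • a y + g y • lieDerivVec X a y := by
  have h : fderiv ℝ (fun z ↦ g z • a z) y = g y • fderiv ℝ a y + (fderiv ℝ g y).smulRight (a y) :=
    fderiv_fun_smul hg ha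
  ext v
  simp only [lieDerivVec, h]
  simp [fderivCompContinuousLinearMap_apply, Finset.mul_sum]
  ring

end LieDerivative

/-! ### Diffeomorphisms, charts and the naturality of the exterior differential -/

section Naturality

variable {E : Type*} [NormedAddCommGroup E] [NormedSpace ℝ E]
  {M : Type*} [TopologicalSpace M] [ChartedSpace E M]
  {E' : Type*} [NormedAddCommGroup E'] [NormedSpace ℝ E']
  {M' : Type*} [TopologicalSpace M'] [ChartedSpace E' M']

theorem contDiffAt_writtenInExtChartAt {Φ : M → M'} (hΦ : ContMDiff 𝓘(ℝ, E) 𝓘(ℝ, E') ∞ Φ)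
    (x : M) : ContDiffAt ℝ ∞ (writtenInExtChartAt 𝓘(ℝ, E) 𝓘(ℝ, E') x Φ)
      (extChartAt 𝓘(ℝ, E) x x) := by
  have := (contMDiffAt_iff.1 (hΦ x)).2
  rwa [modelWithCornersSelf_coe, range_id, contDiffWithinAt_univ] at this

theorem fderiv_writtenInExtChartAt {Φ : M → M'} (hΦ : ContMDiff 𝓘(ℝ, E) 𝓘(ℝ, E') ∞ Φ) (x : M) :
    fderiv ℝ (writtenInExtChartAt 𝓘(ℝ, E) 𝓘(ℝ, E') x Φ) (extChartAt 𝓘(ℝ, E) x x) =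
      mfderiv 𝓘(ℝ, E) 𝓘(ℝ, E') Φ x := by
  rw [((hΦ x).mdifferentiableAt (by simp)).mfderiv, modelWithCornersSelf_coe, range_id,
    fderivWithin_univ]

theorem writtenInExtChartAt_self (Φ : M → M') (x : M) :
    writtenInExtChartAt 𝓘(ℝ, E) 𝓘(ℝ, E') x Φ (extChartAt 𝓘(ℝ, E) x x) =
      extChartAt 𝓘(ℝ, E') (Φ x) (Φ x) := by
  simp [writtenInExtChartAt]

/-- Fibers of the tangent bundle over equal points are all the model space `E`, so values at equal
points can be compared without transport. -/
theorem VField.congr_point (X : VField E M) {p q : M} (h : p = q) : (X p : E) = (X q : E) := by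
  subst h; rfl

theorem DForm.congr_point {k : ℕ} (α : DForm E M k) {p q : M} (h : p = q) {v w : Fin k → E}
    (hvw : v = w) : (α p : E [⋀^Fin k]→L[ℝ] ℝ) v = (α q : E [⋀^Fin k]→L[ℝ] ℝ) w := by
  subst h hvw; rfl

theorem mfderiv_symm_comp_mfderiv (Φ : M ≃ₘ⟮𝓘(ℝ, E), 𝓘(ℝ, E')⟯ M') (x : M) :
    (mfderiv 𝓘(ℝ, E') 𝓘(ℝ, E) Φ.symm (Φ x) : E' →L[ℝ] E).comp
      (mfderiv 𝓘(ℝ, E) 𝓘(ℝ, E') Φ x : E →L[ℝ] E') = ContinuousLinearMap.id ℝ E := by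
  have h1 := mfderiv_comp (I := 𝓘(ℝ, E)) (I'' := 𝓘(ℝ, E)) x
    (Φ.symm.mdifferentiable (by simp) (Φ x)) (Φ.mdifferentiable (by simp) x)
  have h2 : (Φ.symm ∘ Φ : M → M) = id := funext Φ.symm_apply_apply
  rw [h2, mfderiv_id] at h1
  exact h1.symm

theorem mfderiv_comp_mfderiv_symm (Φ : M ≃ₘ⟮𝓘(ℝ, E), 𝓘(ℝ, E')⟯ M') (x : M) :
    (mfderiv 𝓘(ℝ, E) 𝓘(ℝ, E') Φ x : E →L[ℝ] E').comp
      (mfderiv 𝓘(ℝ, E') 𝓘(ℝ, E) Φ.symm (Φ x) : E' →L[ℝ] E) = ContinuousLinearMap.id ℝ E' := by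
  have h := mfderiv_symm_comp_mfderiv Φ.symm (Φ x)
  rwa [Φ.symm_apply_apply] at h

/-- The pushforward, defined by inverting the derivative of `Φ.symm`, is given by the derivative of
`Φ`. -/
theorem VField.pushforward_apply (Φ : M ≃ₘ⟮𝓘(ℝ, E), 𝓘(ℝ, E')⟯ M') (X : VField E M) (x : M) :
    VField.pushforward Φ X (Φ x) = mfderiv 𝓘(ℝ, E) 𝓘(ℝ, E') Φ x (X x) := by
  have h := ContinuousLinearMap.inverse_eq (mfderiv_symm_comp_mfderiv Φ x)
    (mfderiv_comp_mfderiv_symm Φ x)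
  exact congrArg₂ (fun (L : E →L[ℝ] E') (v : E) ↦ L v) h (X.congr_point (Φ.symm_apply_apply x))

theorem VField.pushforward_pushforward_symm (Φ : M ≃ₘ⟮𝓘(ℝ, E), 𝓘(ℝ, E')⟯ M') (Y : VField E' M') :
    VField.pushforward Φ (VField.pushforward Φ.symm Y) = Y := by
  funext y
  have h := congrArg (fun L : E' →L[ℝ] E' ↦ L (Y y)) (mfderiv_symm_comp_mfderiv Φ.symm y)
  have h1 : (VField.pushforward Φ (VField.pushforward Φ.symm Y) (Φ (Φ.symm y)) : E') =
      (mfderiv 𝓘(ℝ, E) 𝓘(ℝ, E') Φ (Φ.symm y) : E →L[ℝ] E')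
        (mfderiv 𝓘(ℝ, E') 𝓘(ℝ, E) Φ.symm y (Y y)) := by
    rw [VField.pushforward_apply, VField.pushforward_apply]
  exact ((VField.congr_point _ (Φ.apply_symm_apply y)).symm.trans h1).trans h

theorem pullback_symm_pullback {k : ℕ} (Φ : M ≃ₘ⟮𝓘(ℝ, E), 𝓘(ℝ, E')⟯ M') (β : DForm E' M' k) :
    DForm.pullback (E := E') (E' := E) Φ.symm (DForm.pullback (E := E) Φ β) = β := by
  funext y
  ext v
  exact β.congr_point (Φ.apply_symm_apply y) (funext fun i ↦
    congrArg (fun L : E' →L[ℝ] E' ↦ L (v i)) (mfderiv_symm_comp_mfderiv Φ.symm y))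

theorem pullback_apply_eq_zero_iff {k : ℕ} (Φ : M ≃ₘ⟮𝓘(ℝ, E), 𝓘(ℝ, E')⟯ M') (β : DForm E' M' k)
    (x : M) : DForm.pullback (E := E) Φ β x = 0 ↔ β (Φ x) = 0 := by
  constructor
  · intro h
    have h1 := congrFun (pullback_symm_pullback Φ β) (Φ x)
    rw [← h1]
    ext v
    have h2 : ∀ p (_ : p = x) (w : Fin k → E),
        (DForm.pullback (E := E) Φ β p : E [⋀^Fin k]→L[ℝ] ℝ) w = 0 := by
      rintro p rfl w
      exact congrArg (fun b : E [⋀^Fin k]→L[ℝ] ℝ ↦ b w) h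
    exact h2 _ (Φ.symm_apply_apply x) _
  · intro h
    rw [DForm.pullback, h]
    rfl

/-- For `c ≠ 0` the constant is `c⁻¹`; for `c = 0` the form `Ω'` is zero and nondegenerate, so the
tangent spaces are trivial and any constant will do. -/
theorem exists_pullback_symm_eq_smul {Ω : DForm E M 2} {Ω' : DForm E' M' 2}
    (hΩ' : IsSymplectic Ω') {Φ : M ≃ₘ⟮𝓘(ℝ, E), 𝓘(ℝ, E')⟯ M'} {c : ℝ}
    (h : DForm.pullback Φ Ω' = c • Ω) :
    ∃ c' : ℝ, DForm.pullback (E := E') (E' := E) Φ.symm Ω = c' • Ω' := by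
  rcases eq_or_ne c 0 with rfl | hc
  · refine ⟨0, funext fun y ↦ ?_⟩
    have hzero : ∀ x, Ω' (Φ x) = 0 := fun x ↦ (pullback_apply_eq_zero_iff Φ _ x).1 (by
      rw [h, zero_smul]; rfl)
    have hy : (Ω' y : E' [⋀^Fin 2]→L[ℝ] ℝ) = 0 := by
      rw [← Φ.apply_symm_apply y]; exact hzero _
    have hs : ∀ v : E', v = 0 := fun v ↦ hΩ'.nondegenerate y v fun w ↦ by
      exact congrArg (fun b : E' [⋀^Fin 2]→L[ℝ] ℝ ↦ b ![v, w]) hy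
    suffices ∀ b b' : E' [⋀^Fin 2]→L[ℝ] ℝ, b = b' from this _ _
    intro b b'
    ext v
    rw [map_coord_zero b 0 (hs _), map_coord_zero b' 0 (hs _)]
  · refine ⟨c⁻¹, ?_⟩
    have h1 : Ω = c⁻¹ • DForm.pullback Φ Ω' := by rw [h, smul_smul, inv_mul_cancel₀ hc, one_smul]
    calc DForm.pullback (E := E') (E' := E) Φ.symm Ω
        = c⁻¹ • DForm.pullback (E := E') (E' := E) Φ.symm (DForm.pullback Φ Ω') := by rw [h1]; rfl
      _ = c⁻¹ • Ω' := by rw [pullback_symm_pullback]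

theorem contraction_pullback {k : ℕ} (Φ : M ≃ₘ⟮𝓘(ℝ, E), 𝓘(ℝ, E')⟯ M') (X : VField E M)
    (β : DForm E' M' (k + 1)) :
    contraction X (DForm.pullback Φ β) =
      DForm.pullback Φ (contraction (VField.pushforward Φ X) β) := by
  funext x
  ext v
  change β (Φ x) _ = β (Φ x) _
  congr 1
  ext i
  refine Fin.cases ?_ (fun i ↦ ?_) i
  · exact (VField.pushforward_apply Φ X x).symm
  · rfl

variable [IsManifold 𝓘(ℝ, E) ∞ M] [IsManifold 𝓘(ℝ, E') ∞ M']

/-- The preferred chart at `x` is the one that trivializes `T_x M` by the identity. -/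
theorem mfderiv_extChartAt_symm_self (x : M) :
    mfderiv 𝓘(ℝ, E) 𝓘(ℝ, E) (extChartAt 𝓘(ℝ, E) x).symm (extChartAt 𝓘(ℝ, E) x x) =
      ContinuousLinearMap.id ℝ E := by
  have := mfderivWithin_range_extChartAt_symm (I := 𝓘(ℝ, E)) (x := x)
  rwa [modelWithCornersSelf_coe, range_id, mfderivWithin_univ] at this

theorem isInvertible_mfderiv_extChartAt_symm {x : M} {y : E}
    (hy : y ∈ (extChartAt 𝓘(ℝ, E) x).target) :
    (mfderiv 𝓘(ℝ, E) 𝓘(ℝ, E) (extChartAt 𝓘(ℝ, E) x).symm y).IsInvertible := by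
  have := isInvertible_mfderivWithin_extChartAt_symm (I := 𝓘(ℝ, E)) hy
  rwa [modelWithCornersSelf_coe, range_id, mfderivWithin_univ] at this

/-- The preferred chart at `x` has the identity as derivative at `x`, so that `ofChartAt` changes
only the type. -/
theorem ofChartAt_eq {k : ℕ} (x : M) (a : E [⋀^Fin k]→L[ℝ] ℝ) : ofChartAt x a = a := by
  rw [ofChartAt, mfderiv_extChartAt_self]
  rfl

theorem DForm.inChart_self {k : ℕ} (α : DForm E M k) (x : M) :
    α.inChart x (extChartAt 𝓘(ℝ, E) x x) = α x := by
  rw [DForm.inChart, mfderiv_extChartAt_symm_self]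
  have := extChartAt_to_inv (I := 𝓘(ℝ, E)) x
  ext v
  change α _ v = α x v
  rw [this]

theorem DForm.d_apply {k : ℕ} (α : DForm E M k) (x : M) :
    α.d x = extDeriv (α.inChart x) (extChartAt 𝓘(ℝ, E) x x) := ofChartAt_eq x _

theorem lieDeriv_apply {k : ℕ} (X : VField E M) (α : DForm E M k) (x : M) :
    lieDeriv X α x =
      lieDerivVec (VField.inChart X x) (α.inChart x) (extChartAt 𝓘(ℝ, E) x x) :=
  ofChartAt_eq x _

theorem inChart_contraction {k : ℕ} (X : VField E M) (α : DForm E M (k + 1)) {x : M} {y : E}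
    (hy : y ∈ (extChartAt 𝓘(ℝ, E) x).target) :
    (contraction X α).inChart x y = curryLeft (α.inChart x y) (VField.inChart X x y) := by
  ext v
  have h := (isInvertible_mfderiv_extChartAt_symm hy).self_apply_inverse
    (X ((extChartAt 𝓘(ℝ, E) x).symm y))
  change α _ _ = α _ _
  congr 1
  ext i
  refine Fin.cases ?_ (fun i ↦ ?_) i
  · exact h.symm
  · rfl

theorem VField.IsSmooth.contDiffAt_inChart [CompleteSpace E] {X : VField E M}
    (hX : VField.IsSmooth X) (x : M) :
    ContDiffAt ℝ ∞ (VField.inChart X x) (extChartAt 𝓘(ℝ, E) x x) := by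
  have : IsManifold 𝓘(ℝ, E) (∞ + 1) M := ‹IsManifold 𝓘(ℝ, E) ∞ M›
  have h := VectorField.contMDiffWithinAt_mpullbackWithin_extChartAt_symm (I := 𝓘(ℝ, E))
    (n := ∞) (m := ∞) ((hX x).contMDiffWithinAt (s := univ)) uniqueMDiffOn_univ (mem_univ x)
    (by simp)
  rw [modelWithCornersSelf_coe, range_id, VectorField.mpullbackWithin_univ,
    contMDiffWithinAt_vectorSpace_iff_contDiffWithinAt] at h
  exact h.contDiffAt (by simpa using extChartAt_target_mem_nhds (I := 𝓘(ℝ, E)) x)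

/-- Smoothness of a vector field can be tested at the base point of each preferred chart. -/
theorem VField.IsSmooth.of_inChart [CompleteSpace E] {X : VField E M}
    (hX : ∀ x : M, ContDiffAt ℝ ∞ (VField.inChart X x) (extChartAt 𝓘(ℝ, E) x x)) :
    VField.IsSmooth X := by
  intro x
  have : IsManifold 𝓘(ℝ, E) (∞ + 1) M := ‹IsManifold 𝓘(ℝ, E) ∞ M›
  have h := VectorField.eventuallyEq_mpullback_mpullbackWithin_extChartAt (I := 𝓘(ℝ, E)) (x := x)
    (s := univ) X
  rw [modelWithCornersSelf_coe, range_id, VectorField.mpullbackWithin_univ, nhdsWithin_univ] at h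
  have h2 := ContMDiffAt.mpullback_vectorField_preimage (I := 𝓘(ℝ, E)) (I' := 𝓘(ℝ, E)) (m := ∞)
    (n := ∞) (f := extChartAt 𝓘(ℝ, E) x) (x₀ := x) (contMDiffAt_vectorSpace_iff_contDiffAt.2 (hX x))
    contMDiffAt_extChartAt (isInvertible_mfderiv_extChartAt (mem_extChartAt_source x)) (by simp)
  refine h2.congr_of_eventuallyEq ?_
  filter_upwards [h] with y hy
  exact congrArg (fun v : TangentSpace 𝓘(ℝ, E) y ↦ (v : TangentBundle 𝓘(ℝ, E) M)) hy

/-- The consequence of Cartan's formula used for `Ω` itself and for pullbacks of symplectic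
forms. -/
theorem lieDeriv_eq_zero_of_closed {k : ℕ} {X : VField E M} {α : DForm E M (k + 1)} {x : M}
    (hα : DifferentiableAt ℝ (α.inChart x) (extChartAt 𝓘(ℝ, E) x x))
    (hX : DifferentiableAt ℝ (VField.inChart X x) (extChartAt 𝓘(ℝ, E) x x))
    (hd : α.d x = 0) (hc : (contraction X α).d x = 0) : lieDeriv X α x = 0 := by
  rw [DForm.d_apply] at hd hc
  have h : (contraction X α).inChart x =ᶠ[𝓝 (extChartAt 𝓘(ℝ, E) x x)]
      fun z ↦ curryLeft (α.inChart x z) (VField.inChart X x z) := by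
    filter_upwards [extChartAt_target_mem_nhds x] with z hz using inChart_contraction X α hz
  rw [h.extDeriv_eq] at hc
  rw [lieDeriv_apply, lieDerivVec_eq_cartan hα hX]
  rw [show extDeriv (α.inChart x) (extChartAt 𝓘(ℝ, E) x x) = 0 from hd,
    show extDeriv _ (extChartAt 𝓘(ℝ, E) x x) = 0 from hc, curryLeft_zero, zero_add]
  rfl

/-- In charts, the pullback by `Φ` is the pullback by the coordinate expression of `Φ`. -/
theorem DForm.inChart_pullback {k : ℕ} {Φ : M → M'} (hΦ : ContMDiff 𝓘(ℝ, E) 𝓘(ℝ, E') ∞ Φ)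
    (β : DForm E' M' k) (x : M) :
    (DForm.pullback Φ β).inChart x =ᶠ[𝓝 (extChartAt 𝓘(ℝ, E) x x)] fun y ↦
      (β.inChart (Φ x) (writtenInExtChartAt 𝓘(ℝ, E) 𝓘(ℝ, E') x Φ y)).compContinuousLinearMap
        (fderiv ℝ (writtenInExtChartAt 𝓘(ℝ, E) 𝓘(ℝ, E') x Φ) y) := by
  set φ := extChartAt 𝓘(ℝ, E) x
  set ψ := extChartAt 𝓘(ℝ, E') (Φ x)
  have hopen : IsOpen (φ.target ∩ φ.symm ⁻¹' (Φ ⁻¹' ψ.source)) :=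
    (continuousOn_extChartAt_symm x).isOpen_inter_preimage (isOpen_extChartAt_target x)
      ((isOpen_extChartAt_source (Φ x)).preimage hΦ.continuous)
  have hmem : φ x ∈ φ.target ∩ φ.symm ⁻¹' (Φ ⁻¹' ψ.source) :=
    ⟨mem_extChartAt_target x, by simp [φ, ψ]⟩
  filter_upwards [hopen.mem_nhds hmem] with y hy
  have hφ : MDifferentiableAt 𝓘(ℝ, E) 𝓘(ℝ, E) φ.symm y :=
    ((contMDiffOn_extChartAt_symm (n := ∞) x).contMDiffAt
      ((isOpen_extChartAt_target x).mem_nhds hy.1)).mdifferentiableAt (by simp)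
  have hΦ' : MDifferentiableAt 𝓘(ℝ, E) 𝓘(ℝ, E') Φ (φ.symm y) :=
    (hΦ _).mdifferentiableAt (by simp)
  have hψ : MDifferentiableAt 𝓘(ℝ, E') 𝓘(ℝ, E') ψ (Φ (φ.symm y)) :=
    mdifferentiableAt_extChartAt (by simpa [ψ] using hy.2)
  have hψt : ψ (Φ (φ.symm y)) ∈ ψ.target := ψ.map_source hy.2
  have hψs : MDifferentiableAt 𝓘(ℝ, E') 𝓘(ℝ, E') ψ.symm (ψ (Φ (φ.symm y))) :=
    ((contMDiffOn_extChartAt_symm (n := ∞) (Φ x)).contMDiffAt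
      ((isOpen_extChartAt_target (Φ x)).mem_nhds hψt)).mdifferentiableAt (by simp)
  have hg : MDifferentiableAt 𝓘(ℝ, E) 𝓘(ℝ, E') (writtenInExtChartAt 𝓘(ℝ, E) 𝓘(ℝ, E') x Φ) y :=
    hψ.comp y (hΦ'.comp y hφ)
  have e1 : mfderiv 𝓘(ℝ, E) 𝓘(ℝ, E') (Φ ∘ φ.symm) y =
      (mfderiv 𝓘(ℝ, E) 𝓘(ℝ, E') Φ (φ.symm y)).comp (mfderiv 𝓘(ℝ, E) 𝓘(ℝ, E) φ.symm y) :=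
    mfderiv_comp y hΦ' hφ
  have e2 : mfderiv 𝓘(ℝ, E) 𝓘(ℝ, E') (ψ.symm ∘ writtenInExtChartAt 𝓘(ℝ, E) 𝓘(ℝ, E') x Φ) y =
      (mfderiv 𝓘(ℝ, E') 𝓘(ℝ, E') ψ.symm (ψ (Φ (φ.symm y)))).comp
        (mfderiv 𝓘(ℝ, E) 𝓘(ℝ, E') (writtenInExtChartAt 𝓘(ℝ, E) 𝓘(ℝ, E') x Φ) y) :=
    mfderiv_comp y hψs hg
  have e3 : ψ.symm ∘ writtenInExtChartAt 𝓘(ℝ, E) 𝓘(ℝ, E') x Φ =ᶠ[𝓝 y] Φ ∘ φ.symm := by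
    filter_upwards [hopen.mem_nhds hy] with z hz
    exact ψ.left_inv hz.2
  have e4 : ψ.symm (writtenInExtChartAt 𝓘(ℝ, E) 𝓘(ℝ, E') x Φ y) = Φ (φ.symm y) :=
    e3.self_of_nhds
  have e5 : ∀ v : E, (mfderiv 𝓘(ℝ, E') 𝓘(ℝ, E') ψ.symm (ψ (Φ (φ.symm y))) : E' →L[ℝ] E')
      (fderiv ℝ (writtenInExtChartAt 𝓘(ℝ, E) 𝓘(ℝ, E') x Φ) y v) =
      (mfderiv 𝓘(ℝ, E) 𝓘(ℝ, E') Φ (φ.symm y) : E →L[ℝ] E')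
        ((mfderiv 𝓘(ℝ, E) 𝓘(ℝ, E) φ.symm y : E →L[ℝ] E) v) := by
    intro v
    rw [e3.mfderiv_eq, e1] at e2
    have := congrArg (fun L : E →L[ℝ] E' ↦ L v) e2
    rw [mfderiv_eq_fderiv] at this
    exact this.symm
  ext v
  exact β.congr_point e4.symm (funext fun i ↦ (e5 (v i)).symm)

theorem DForm.differentiableAt_inChart_pullback {k : ℕ} {Φ : M → M'}
    (hΦ : ContMDiff 𝓘(ℝ, E) 𝓘(ℝ, E') ∞ Φ) {β : DForm E' M' k} {x : M}
    (hβ : DifferentiableAt ℝ (β.inChart (Φ x)) (extChartAt 𝓘(ℝ, E') (Φ x) (Φ x))) :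
    DifferentiableAt ℝ ((DForm.pullback Φ β).inChart x) (extChartAt 𝓘(ℝ, E) x x) := by
  have hg := contDiffAt_writtenInExtChartAt hΦ x
  refine DifferentiableAt.congr_of_eventuallyEq ?_ (DForm.inChart_pullback hΦ β x)
  rw [← writtenInExtChartAt_self (E := E)] at hβ
  refine DifferentiableAt.continuousAlternatingMapCompContinuousLinearMap
    (hβ.comp _ (hg.differentiableAt (by simp))) ?_
  exact (hg.fderiv_right (m := 1) (by norm_cast)).differentiableAt (by simp)

/-- The exterior differential commutes with pullback; differentiability at the single point `Φ x`
is enough. -/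
theorem DForm.d_pullback {k : ℕ} {Φ : M → M'}
    (hΦ : ContMDiff 𝓘(ℝ, E) 𝓘(ℝ, E') ∞ Φ) {β : DForm E' M' k} {x : M}
    (hβ : DifferentiableAt ℝ (β.inChart (Φ x)) (extChartAt 𝓘(ℝ, E') (Φ x) (Φ x))) :
    (DForm.pullback (E := E) Φ β).d x = DForm.pullback (E := E) Φ β.d x := by
  rw [← writtenInExtChartAt_self (E := E)] at hβ
  rw [DForm.d_apply, (DForm.inChart_pullback hΦ β x).extDeriv_eq,
    extDeriv_pullback hβ (contDiffAt_writtenInExtChartAt hΦ x) (by simp; norm_cast),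
    fderiv_writtenInExtChartAt hΦ, writtenInExtChartAt_self, DForm.pullback, DForm.d_apply]
  rfl

theorem VField.IsSmooth.pushforward [CompleteSpace E'] {X : VField E M} (hX : X.IsSmooth)
    (Φ : M ≃ₘ⟮𝓘(ℝ, E), 𝓘(ℝ, E')⟯ M') : (VField.pushforward Φ X).IsSmooth := by
  have : IsManifold 𝓘(ℝ, E) (∞ + 1) M := ‹IsManifold 𝓘(ℝ, E) ∞ M›
  have : IsManifold 𝓘(ℝ, E') (∞ + 1) M' := ‹IsManifold 𝓘(ℝ, E') ∞ M'›
  refine ContMDiff.mpullback_vectorField (n := ∞) hX Φ.symm.contMDiff (fun y ↦ ?_) (by simp)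
  exact ContinuousLinearMap.IsInvertible.of_inverse (mfderiv_comp_mfderiv_symm Φ.symm y)
    (mfderiv_symm_comp_mfderiv Φ.symm y)

end Naturality

/-! ### Hamiltonian vector fields -/

section HamiltonianFields

variable {E : Type*} [NormedAddCommGroup E] [NormedSpace ℝ E]
  {M : Type*} [TopologicalSpace M] [ChartedSpace E M]

theorem DForm.IsSmooth.contDiffAt {k : ℕ} {α : DForm E M k} (hα : α.IsSmooth) {x : M} {y : E}
    (hy : y ∈ (extChartAt 𝓘(ℝ, E) x).target) : ContDiffAt ℝ ∞ (α.inChart x) y :=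
  (hα x).contDiffAt ((isOpen_extChartAt_target x).mem_nhds hy)

/-- The differential of a function, as a form of degree `1`. -/
noncomputable def functionDifferential (f : M → ℝ) : DForm E M 1 :=
  fun x ↦ ofSubsingleton ℝ E ℝ (0 : Fin 1) (mfderiv 𝓘(ℝ, E) 𝓘(ℝ, ℝ) f x : E →L[ℝ] ℝ)

/-- The Hamiltonian vector field of `f`: the solution `X` of `i(X) Ω = df`. -/
noncomputable def hamiltonianField (Ω : DForm E M 2) (f : M → ℝ) : VField E M :=
  fun x ↦ (curryLeft (E := E) (Ω x)).inverse (functionDifferential f x)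

theorem contraction_hamiltonianField [FiniteDimensional ℝ E] {Ω : DForm E M 2}
    (hΩ : IsSymplectic Ω) (f : M → ℝ) :
    contraction (hamiltonianField Ω f) Ω = functionDifferential f := by
  funext x
  exact (isInvertible_curryLeft (V := E) (hΩ.nondegenerate x)).self_apply_inverse _

variable [IsManifold 𝓘(ℝ, E) ∞ M]

theorem contDiffAt_comp_extChartAt_symm {f : M → ℝ} (hf : ContMDiff 𝓘(ℝ, E) 𝓘(ℝ, ℝ) ∞ f)
    {x : M} {y : E} (hy : y ∈ (extChartAt 𝓘(ℝ, E) x).target) :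
    ContDiffAt ℝ ∞ (f ∘ (extChartAt 𝓘(ℝ, E) x).symm) y :=
  ((hf _).comp y ((contMDiffOn_extChartAt_symm (n := ∞) x).contMDiffAt
      ((isOpen_extChartAt_target x).mem_nhds hy))).contDiffAt

theorem inChart_functionDifferential {f : M → ℝ} (hf : ContMDiff 𝓘(ℝ, E) 𝓘(ℝ, ℝ) ∞ f)
    {x : M} {y : E} (hy : y ∈ (extChartAt 𝓘(ℝ, E) x).target) :
    (functionDifferential f).inChart x y =
      ofSubsingleton ℝ E ℝ (0 : Fin 1) (fderiv ℝ (f ∘ (extChartAt 𝓘(ℝ, E) x).symm) y) := by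
  have hφ : MDifferentiableAt 𝓘(ℝ, E) 𝓘(ℝ, E) (extChartAt 𝓘(ℝ, E) x).symm y :=
    ((contMDiffOn_extChartAt_symm (n := ∞) x).contMDiffAt
      ((isOpen_extChartAt_target x).mem_nhds hy)).mdifferentiableAt (by simp)
  have h := mfderiv_comp y ((hf _).mdifferentiableAt (by simp)) hφ
  rw [mfderiv_eq_fderiv] at h
  ext v
  exact congrArg (fun L : E →L[ℝ] ℝ ↦ L (v 0)) h.symm

theorem functionDifferential_d {f : M → ℝ} (hf : ContMDiff 𝓘(ℝ, E) 𝓘(ℝ, ℝ) ∞ f) :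
    (functionDifferential f : DForm E M 1).d = 0 := by
  funext x
  have h : (functionDifferential f).inChart x =ᶠ[𝓝 (extChartAt 𝓘(ℝ, E) x x)]
      extDeriv fun y ↦ constOfIsEmpty ℝ E (Fin 0) ((f ∘ (extChartAt 𝓘(ℝ, E) x).symm) y) := by
    filter_upwards [extChartAt_target_mem_nhds (I := 𝓘(ℝ, E)) x] with y hy
    rw [inChart_functionDifferential hf hy, extDeriv_constOfIsEmpty]
  rw [DForm.d_apply, h.extDeriv_eq]
  refine extDeriv_extDeriv_apply (r := ∞) ?_ (by simp; norm_cast)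
  exact (constOfIsEmptyLIE ℝ E ℝ (Fin 0)).toContinuousLinearEquiv.contDiff.contDiffAt.comp _
    (contDiffAt_comp_extChartAt_symm hf (mem_extChartAt_target x))

/-- Nondegeneracy is preserved on the whole chart domain, since the derivative of the inverse chart
is invertible there. -/
theorem IsSymplectic.inChart_nondegenerate {Ω : DForm E M 2} (hΩ : IsSymplectic Ω) {x : M} {y : E}
    (hy : y ∈ (extChartAt 𝓘(ℝ, E) x).target) {u : E} (hu : ∀ v, Ω.inChart x y ![u, v] = 0) :
    u = 0 := by
  obtain ⟨e, he⟩ := isInvertible_mfderiv_extChartAt_symm hy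
  refine e.map_eq_zero_iff.1 (hΩ.nondegenerate _ _ fun w ↦ ?_)
  rw [← hu (e.symm w), DForm.inChart, ← he]
  change Ω _ _ = Ω _ _
  congr 1
  ext i
  fin_cases i
  · rfl
  · exact (e.apply_symm_apply w).symm

variable [FiniteDimensional ℝ E]

theorem curryLeft_inChart_hamiltonianField {Ω : DForm E M 2} (hΩ : IsSymplectic Ω) {f : M → ℝ}
    (hf : ContMDiff 𝓘(ℝ, E) 𝓘(ℝ, ℝ) ∞ f) {x : M} {y : E}
    (hy : y ∈ (extChartAt 𝓘(ℝ, E) x).target) :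
    curryLeft (Ω.inChart x y) ((hamiltonianField Ω f).inChart x y) =
      ofSubsingleton ℝ E ℝ (0 : Fin 1) (fderiv ℝ (f ∘ (extChartAt 𝓘(ℝ, E) x).symm) y) := by
  rw [← inChart_contraction _ _ hy, contraction_hamiltonianField hΩ,
    inChart_functionDifferential hf hy]

/-- In a chart, the field is the inverse of `v ↦ Ω(v, ·)` applied to `df`, and inversion of
invertible operators is smooth. -/
theorem hamiltonianField_isSmooth {Ω : DForm E M 2} (hΩ : IsSymplectic Ω) {f : M → ℝ}
    (hf : ContMDiff 𝓘(ℝ, E) 𝓘(ℝ, ℝ) ∞ f) : (hamiltonianField Ω f).IsSmooth := by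
  have : CompleteSpace E := FiniteDimensional.complete ℝ E
  refine VField.IsSmooth.of_inChart fun x ↦ ?_
  set y₀ := extChartAt 𝓘(ℝ, E) x x
  have hinv : ∀ y ∈ (extChartAt 𝓘(ℝ, E) x).target, (curryLeft (Ω.inChart x y)).IsInvertible :=
    fun y hy ↦ isInvertible_curryLeft fun u hu ↦ hΩ.inChart_nondegenerate hy hu
  have hy₀ : y₀ ∈ (extChartAt 𝓘(ℝ, E) x).target := mem_extChartAt_target x
  have h : (hamiltonianField Ω f).inChart x =ᶠ[𝓝 y₀] fun y ↦
      (curryLeft (Ω.inChart x y)).inverse (ofSubsingletonLIE (𝕜 := ℝ) (E := E) (F := ℝ) (0 : Fin 1)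
        (fderiv ℝ (f ∘ (extChartAt 𝓘(ℝ, E) x).symm) y)) := by
    filter_upwards [extChartAt_target_mem_nhds (I := 𝓘(ℝ, E)) x] with y hy
    exact ((hinv y hy).inverse_apply_eq.2 (curryLeft_inChart_hamiltonianField hΩ hf hy).symm).symm
  refine ContDiffAt.congr_of_eventuallyEq ?_ h
  have h1 : ContDiffAt ℝ ∞ (fun y ↦ curryLeft (Ω.inChart x y)) y₀ :=
    contDiffAt_curryLeft (hΩ.smooth.contDiffAt hy₀)
  have h2 : ContDiffAt ℝ ∞ (fderiv ℝ (f ∘ (extChartAt 𝓘(ℝ, E) x).symm)) y₀ :=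
    (contDiffAt_comp_extChartAt_symm hf hy₀).fderiv_right (by simp)
  have h3 : ContDiffAt ℝ ∞ (fun y ↦ (curryLeft (Ω.inChart x y)).inverse) y₀ :=
    ContDiffAt.comp (g := ContinuousLinearMap.inverse) y₀ (hinv y₀ hy₀).contDiffAt_map_inverse h1
  exact h3.clm_apply ((ofSubsingletonLIE (𝕜 := ℝ) (E := E) (F := ℝ)
    (0 : Fin 1)).toContinuousLinearEquiv.contDiff.contDiffAt.comp y₀ h2)

theorem hamiltonianField_mem {Ω : DForm E M 2} (hΩ : IsSymplectic Ω) {f : M → ℝ}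
    (hf : ContMDiff 𝓘(ℝ, E) 𝓘(ℝ, ℝ) ∞ f) : hamiltonianField Ω f ∈ locallyHamiltonian Ω :=
  ⟨hamiltonianField_isSmooth hΩ hf, by
    rw [contraction_hamiltonianField hΩ, functionDifferential_d hf]⟩

/-- Any smooth function on the model space is, near the base point of a chart, the expression of a
Hamiltonian whose vector field is defined on all of `M`. -/
theorem exists_locallyHamiltonian [T2Space M] {Ω : DForm E M 2} (hΩ : IsSymplectic Ω) (x : M)
    {f : E → ℝ} (hf : ContDiff ℝ ∞ f) :
    ∃ X ∈ locallyHamiltonian Ω, ∀ᶠ y in 𝓝 (extChartAt 𝓘(ℝ, E) x x), ∀ w,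
      Ω.inChart x y ![X.inChart x y, w] = fderiv ℝ f y w := by
  let ρ : SmoothBumpFunction 𝓘(ℝ, E) x := Classical.arbitrary _
  let F : M → ℝ := fun p ↦ ρ p • (f ∘ extChartAt 𝓘(ℝ, E) x) p
  have hF : ContMDiff 𝓘(ℝ, E) 𝓘(ℝ, ℝ) ∞ F :=
    ρ.contMDiff_smul (hf.contMDiff.comp_contMDiffOn contMDiffOn_extChartAt)
  refine ⟨_, hamiltonianField_mem hΩ hF, ?_⟩
  have hsymm : Tendsto (extChartAt 𝓘(ℝ, E) x).symm (𝓝 (extChartAt 𝓘(ℝ, E) x x)) (𝓝 x) := by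
    have := continuousAt_extChartAt_symm (I := 𝓘(ℝ, E)) x
    rwa [ContinuousAt, extChartAt_to_inv] at this
  have hFf : F ∘ (extChartAt 𝓘(ℝ, E) x).symm =ᶠ[𝓝 (extChartAt 𝓘(ℝ, E) x x)] f := by
    filter_upwards [hsymm.eventually ρ.eventuallyEq_one,
      extChartAt_target_mem_nhds (I := 𝓘(ℝ, E)) x] with y h1 hy
    simp only [F, Function.comp_apply, (extChartAt 𝓘(ℝ, E) x).right_inv hy]
    rw [h1]; simp
  filter_upwards [hFf.eventuallyEq_nhds, extChartAt_target_mem_nhds (I := 𝓘(ℝ, E)) x]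
    with y h1 hy w
  rw [apply_eq_curryLeft, curryLeft_inChart_hamiltonianField hΩ hF hy, h1.fderiv_eq]
  rfl

end HamiltonianFields

/-! ### Invariant forms -/

section Invariants

variable {E : Type*} [NormedAddCommGroup E] [NormedSpace ℝ E]
  {M : Type*} [TopologicalSpace M] [ChartedSpace E M]

theorem DForm.IsSmooth.differentiableAt_inChart {k : ℕ} {α : DForm E M k} (hα : α.IsSmooth)
    (x : M) : DifferentiableAt ℝ (α.inChart x) (extChartAt 𝓘(ℝ, E) x x) :=
  (hα.contDiffAt (mem_extChartAt_target x)).differentiableAt (by simp)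

variable [IsManifold 𝓘(ℝ, E) ∞ M]

/-- A function with zero derivative is constant on the preimage of a ball under a chart. -/
theorem isLocallyConstant_of_hasMFDerivAt_zero {c : M → ℝ}
    (hc : ∀ x, HasMFDerivAt 𝓘(ℝ, E) 𝓘(ℝ, ℝ) c x (0 : E →L[ℝ] ℝ)) : IsLocallyConstant c := by
  rw [IsLocallyConstant.iff_eventually_eq]
  intro x
  set φ := extChartAt 𝓘(ℝ, E) x
  obtain ⟨r, hr, hball⟩ := Metric.isOpen_iff.1 (isOpen_extChartAt_target (I := 𝓘(ℝ, E)) x) (φ x)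
    (mem_extChartAt_target x)
  have hd : ∀ y ∈ Metric.ball (φ x) r, HasFDerivAt (c ∘ φ.symm) (0 : E →L[ℝ] ℝ) y := by
    intro y hy
    have hφ : MDifferentiableAt 𝓘(ℝ, E) 𝓘(ℝ, E) φ.symm y :=
      ((contMDiffOn_extChartAt_symm (n := ∞) x).contMDiffAt
        ((isOpen_extChartAt_target x).mem_nhds (hball hy))).mdifferentiableAt (by simp)
    have h := ((hc (φ.symm y)).comp y hφ.hasMFDerivAt).hasFDerivAt
    exact h.congr_fderiv (ContinuousLinearMap.zero_comp _)
  have hφ : ∀ᶠ p in 𝓝 x, φ p ∈ Metric.ball (φ x) r :=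
    (continuousAt_extChartAt x).eventually (Metric.ball_mem_nhds _ hr)
  filter_upwards [hφ, extChartAt_source_mem_nhds (I := 𝓘(ℝ, E)) x] with p hp hps
  have h := (convex_ball (φ x) r).is_const_of_fderivWithin_eq_zero (𝕜 := ℝ) (f := c ∘ φ.symm)
    (fun y hy ↦ (hd y hy).differentiableAt.differentiableWithinAt)
    (fun y hy ↦ by
      rw [fderivWithin_of_isOpen Metric.isOpen_ball hy, (hd y hy).fderiv]) hp
    (Metric.mem_ball_self hr)
  exact ((congrArg c (φ.left_inv hps)).symm.trans h).trans (congrArg c (extChartAt_to_inv x))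

variable [FiniteDimensional ℝ E]

theorem VField.IsSmooth.differentiableAt_inChart {X : VField E M} (hX : X.IsSmooth) (x : M) :
    DifferentiableAt ℝ (X.inChart x) (extChartAt 𝓘(ℝ, E) x x) := by
  have : CompleteSpace E := FiniteDimensional.complete ℝ E
  exact (hX.contDiffAt_inChart x).differentiableAt (by simp)

theorem IsSymplectic.lieDeriv_eq_zero {Ω : DForm E M 2} (hΩ : IsSymplectic Ω) {X : VField E M}
    (hX : X ∈ locallyHamiltonian Ω) : lieDeriv X Ω = 0 :=
  funext fun x ↦ lieDeriv_eq_zero_of_closed (hΩ.smooth.differentiableAt_inChart x)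
    (hX.1.differentiableAt_inChart x) (congrFun hΩ.closed x) (congrFun hX.2 x)

variable [T2Space M]

/-- Locally Hamiltonian fields take every value at a point: use the linear Hamiltonian `Ω(u, ·)`. -/
theorem exists_locallyHamiltonian_inChart_eq {Ω : DForm E M 2} (hΩ : IsSymplectic Ω) (x : M)
    (u : E) : ∃ X ∈ locallyHamiltonian Ω, X.inChart x (extChartAt 𝓘(ℝ, E) x x) = u := by
  set y₀ := extChartAt 𝓘(ℝ, E) x x
  obtain ⟨e, he⟩ := (ofSubsingletonLIE (𝕜 := ℝ) (E := E) (F := ℝ) (0 : Fin 1)).surjective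
    (curryLeft (Ω.inChart x y₀) u)
  obtain ⟨X, hX, h⟩ := exists_locallyHamiltonian hΩ x (f := e) e.contDiff
  refine ⟨X, hX, sub_eq_zero.1 (hΩ.inChart_nondegenerate (mem_extChartAt_target x) fun w ↦ ?_)⟩
  rw [apply_eq_curryLeft, map_sub, ContinuousAlternatingMap.sub_apply, ← apply_eq_curryLeft,
    h.self_of_nhds w, ContinuousLinearMap.fderiv, ← he]
  exact sub_self (e w)

/-- The Hamiltonian `½ Ω(u, · - x)²` has a field that vanishes at `x`, with linear part
`v ↦ Ω(u, v) u`. -/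
theorem exists_locallyHamiltonian_fderiv_inChart_eq {Ω : DForm E M 2} (hΩ : IsSymplectic Ω)
    (x : M) (u : E) : ∃ X ∈ locallyHamiltonian Ω, X.inChart x (extChartAt 𝓘(ℝ, E) x x) = 0 ∧
      ∀ v : E, fderiv ℝ (X.inChart x) (extChartAt 𝓘(ℝ, E) x x) v =
        Ω.inChart x (extChartAt 𝓘(ℝ, E) x x) ![u, v] • u := by
  set y₀ := extChartAt 𝓘(ℝ, E) x x with hy₀
  obtain ⟨e, he⟩ := (ofSubsingletonLIE (𝕜 := ℝ) (E := E) (F := ℝ) (0 : Fin 1)).surjective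
    (curryLeft (Ω.inChart x y₀) u)
  have hev : ∀ v, Ω.inChart x y₀ ![u, v] = e v := fun v ↦ by
    rw [apply_eq_curryLeft, ← he]; rfl
  have he' : ∀ y, HasFDerivAt (fun y ↦ e (y - y₀)) e y := fun y ↦
    e.hasFDerivAt.comp y ((hasFDerivAt_id y).sub_const y₀)
  let f : E → ℝ := fun y ↦ (1 / 2) * (e (y - y₀)) ^ 2
  have hf : ContDiff ℝ ∞ f := by fun_prop
  have hf' : ∀ y w, fderiv ℝ f y w = e (y - y₀) * e w := by
    intro y w
    rw [(((he' y).pow 2).const_mul (1 / 2)).fderiv]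
    simp
    ring
  obtain ⟨X, hX, h⟩ := exists_locallyHamiltonian hΩ x hf
  have hzero : X.inChart x y₀ = 0 :=
    hΩ.inChart_nondegenerate (mem_extChartAt_target x) fun w ↦ by
      rw [← hy₀, h.self_of_nhds w, hf', sub_self, _root_.map_zero, zero_mul]
  refine ⟨X, hX, hzero, fun v ↦ ?_⟩
  refine sub_eq_zero.1 (hΩ.inChart_nondegenerate (mem_extChartAt_target x) fun w ↦ ?_)
  -- Differentiate `i(X) Ω = df` at the zero of `X`: the derivative of `Ω` does not contribute.
  have h1 := hasFDerivAt_curryLeft (hΩ.smooth.differentiableAt_inChart x).hasFDerivAt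
    (hX.1.differentiableAt_inChart x).hasFDerivAt
  have h2 : HasFDerivAt (fun y ↦ e (y - y₀) • curryLeft (Ω.inChart x y₀) u)
      (e.smulRight (curryLeft (Ω.inChart x y₀) u)) y₀ :=
    HasFDerivAt.smul_const (F := E [⋀^Fin 1]→L[ℝ] ℝ) (he' y₀) _
  have h3 : (fun y ↦ curryLeft (Ω.inChart x y) (X.inChart x y)) =ᶠ[𝓝 y₀]
      (fun y ↦ e (y - y₀) • curryLeft (Ω.inChart x y₀) u) := by
    filter_upwards [h] with y hy
    ext w
    have hw : w = ![w 0] := by ext i; fin_cases i; rfl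
    rw [hw, ← apply_eq_curryLeft, hy, hf', ← hev (w 0)]
    rfl
  have h4 := (h1.congr_of_eventuallyEq h3.symm).unique h2
  have h5 := congrArg (fun L : E →L[ℝ] E [⋀^Fin 1]→L[ℝ] ℝ ↦ L v ![w]) h4
  rw [← hy₀, hzero] at h5
  simp only [_root_.map_zero, add_zero] at h5
  rw [apply_eq_curryLeft, map_sub, map_smul, ContinuousAlternatingMap.sub_apply, hev, sub_eq_zero]
  exact h5

/-- At a zero of `X` only the linear part of `X` enters `L(X) α`, so that invariance reads
`Ω(u, v) α(u) = 0`. -/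
theorem IsLHInvariant.eq_zero {Ω : DForm E M 2} (hΩ : IsSymplectic Ω) {α : DForm E M 1}
    (hα : IsLHInvariant Ω α) : α = 0 := by
  funext x
  suffices h : α.inChart x (extChartAt 𝓘(ℝ, E) x x) = 0 from (α.inChart_self x).symm.trans h
  ext u'
  obtain ⟨u, rfl⟩ : ∃ u : E, u' = ![u] := ⟨u' 0, by ext i; fin_cases i; rfl⟩
  obtain ⟨X, hX, h0, hX'⟩ := exists_locallyHamiltonian_fderiv_inChart_eq hΩ x u
  by_contra hne
  have hu : u ≠ 0 := by
    rintro rfl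
    exact hne (map_coord_zero _ 0 rfl)
  obtain ⟨v, hv⟩ : ∃ v : E, Ω.inChart x (extChartAt 𝓘(ℝ, E) x x) ![u, v] ≠ 0 := by
    by_contra! hcon
    exact hu (hΩ.inChart_nondegenerate (mem_extChartAt_target x) hcon)
  have h := congrFun (hα X hX) x
  rw [lieDeriv_apply] at h
  have h1 := congrArg (fun b : E [⋀^Fin 1]→L[ℝ] ℝ ↦ b ![v]) h
  have h2 := (lieDerivVec_apply_one (a := α.inChart x) h0 hX' v).symm.trans h1
  exact hne ((mul_eq_zero.1 h2).resolve_left hv)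

theorem IsLHInvariant.exists_eq_smul_at {Ω : DForm E M 2} (hΩ : IsSymplectic Ω) {α : DForm E M 2}
    (hα : IsLHInvariant Ω α) (x : M) : ∃ c : ℝ, α x = c • Ω x := by
  obtain ⟨c, hc⟩ := exists_eq_smul_of_rankOne_invariant (a := Ω.inChart x (extChartAt 𝓘(ℝ, E) x x))
    (b := α.inChart x (extChartAt 𝓘(ℝ, E) x x))
    (fun u hu ↦ hΩ.inChart_nondegenerate (mem_extChartAt_target x) hu) fun u v w ↦ by
      obtain ⟨X, hX, h0, hX'⟩ := exists_locallyHamiltonian_fderiv_inChart_eq hΩ x u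
      have h := congrFun (hα X hX) x
      rw [lieDeriv_apply] at h
      have h1 := congrArg (fun b : E [⋀^Fin 2]→L[ℝ] ℝ ↦ b ![v, w]) h
      exact (lieDerivVec_apply_two (a := α.inChart x) h0 hX' v w).symm.trans h1
  rw [DForm.inChart_self, DForm.inChart_self] at hc
  exact ⟨c, hc⟩

/-- The factor of proportionality of an invariant `2`-form has derivative zero, because
`0 = L(X) (c Ω) = (X c) Ω` and `X` takes every value at `x`. -/
theorem IsLHInvariant.hasMFDerivAt_zero [Nontrivial E] {Ω : DForm E M 2} (hΩ : IsSymplectic Ω)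
    {α : DForm E M 2} (hα : IsLHInvariant Ω α) {c : M → ℝ} (hc : ∀ x, α x = c x • Ω x) {x : M}
    (hd : DifferentiableAt ℝ (α.inChart x) (extChartAt 𝓘(ℝ, E) x x)) :
    HasMFDerivAt 𝓘(ℝ, E) 𝓘(ℝ, ℝ) c x (0 : E →L[ℝ] ℝ) := by
  set y₀ := extChartAt 𝓘(ℝ, E) x x with hy₀
  let g : E → ℝ := c ∘ (extChartAt 𝓘(ℝ, E) x).symm
  have hgα : ∀ y, α.inChart x y = g y • Ω.inChart x y := by
    intro y
    rw [DForm.inChart, hc]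
    rfl
  have hΩd := hΩ.smooth.differentiableAt_inChart x
  obtain ⟨u, hu⟩ := exists_ne (0 : E)
  obtain ⟨v, hv⟩ : ∃ v : E, Ω.inChart x y₀ ![u, v] ≠ 0 := by
    by_contra! hcon
    exact hu (hΩ.inChart_nondegenerate (mem_extChartAt_target x) hcon)
  have hΩuv : DifferentiableAt ℝ (fun y ↦ Ω.inChart x y ![u, v]) y₀ :=
    hΩd.continuousAlternatingMap_apply fun _ ↦ differentiableAt_const _
  have hgd : DifferentiableAt ℝ g y₀ := by
    -- Near the base point, `c` is the quotient of one coefficient of `α` by that of `Ω`.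
    have h1 : DifferentiableAt ℝ (fun y ↦ α.inChart x y ![u, v] / Ω.inChart x y ![u, v]) y₀ :=
      by
      have h2 : DifferentiableAt ℝ (fun y ↦ α.inChart x y ![u, v]) y₀ :=
        hd.continuousAlternatingMap_apply fun _ ↦ differentiableAt_const _
      simp only [div_eq_mul_inv]
      exact h2.fun_mul (hΩuv.fun_inv hv)
    refine h1.congr_of_eventuallyEq ?_
    filter_upwards [hΩuv.continuousAt.eventually_ne hv] with y hy
    rw [hgα, ContinuousAlternatingMap.smul_apply, smul_eq_mul, mul_div_cancel_right₀ _ hy]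
  have hg0 : fderiv ℝ g y₀ = 0 := by
    ext w
    obtain ⟨X, hX, hXw⟩ := exists_locallyHamiltonian_inChart_eq hΩ x w
    have h1 := congrFun (hα X hX) x
    have h2 := congrFun (hΩ.lieDeriv_eq_zero hX) x
    rw [lieDeriv_apply] at h1 h2
    rw [funext hgα, lieDerivVec_smul hΩd hgd,
      show lieDerivVec _ _ (extChartAt 𝓘(ℝ, E) x x) = 0 from h2, smul_zero, add_zero, hXw] at h1
    have h3 := congrArg (fun b : E [⋀^Fin 2]→L[ℝ] ℝ ↦ b ![u, v]) h1
    exact (mul_eq_zero.1 h3).resolve_right hv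
  have hg : HasFDerivAt g (0 : E →L[ℝ] ℝ) y₀ := hg0 ▸ hgd.hasFDerivAt
  have hcont : ContinuousAt c x := by
    have h1 : ContinuousAt (g ∘ extChartAt 𝓘(ℝ, E) x) x :=
      ContinuousAt.comp hgd.continuousAt (continuousAt_extChartAt x)
    refine h1.congr ?_
    filter_upwards [extChartAt_source_mem_nhds (I := 𝓘(ℝ, E)) x] with p hp
    exact congrArg c ((extChartAt 𝓘(ℝ, E) x).left_inv hp)
  exact ⟨hcont, hg.hasFDerivWithinAt⟩

/-- Differentiability at the base points of the preferred charts replaces smoothness of `α`. -/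
theorem IsLHInvariant.exists_eq_smul [ConnectedSpace M] {Ω : DForm E M 2} (hΩ : IsSymplectic Ω)
    {α : DForm E M 2} (hα : IsLHInvariant Ω α)
    (hd : ∀ x, DifferentiableAt ℝ (α.inChart x) (extChartAt 𝓘(ℝ, E) x x)) :
    ∃ c : ℝ, α = c • Ω := by
  choose c hc using hα.exists_eq_smul_at hΩ
  rcases subsingleton_or_nontrivial E with hE | hE
  -- In dimension zero all `2`-forms vanish, and `Ω` cannot be used to recover `c`.
  · refine ⟨0, funext fun x ↦ ?_⟩
    suffices ∀ b b' : E [⋀^Fin 2]→L[ℝ] ℝ, b = b' from this _ _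
    intro b b'
    ext v
    rw [map_coord_zero b 0 (Subsingleton.elim _ _), map_coord_zero b' 0 (Subsingleton.elim _ _)]
  · have h := isLocallyConstant_of_hasMFDerivAt_zero fun x ↦ hα.hasMFDerivAt_zero hΩ hc (hd x)
    obtain ⟨x₀⟩ := (inferInstance : Nonempty M)
    refine ⟨c x₀, funext fun x ↦ ?_⟩
    rw [hc x, h.apply_eq_of_preconnectedSpace x x₀]
    rfl

end Invariants

/-! ### Canonical transformations -/

section Canonical

variable {E : Type*} [NormedAddCommGroup E] [NormedSpace ℝ E]
  {M : Type*} [TopologicalSpace M] [ChartedSpace E M] [IsManifold 𝓘(ℝ, E) ∞ M]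
  {E' : Type*} [NormedAddCommGroup E'] [NormedSpace ℝ E']
  {M' : Type*} [TopologicalSpace M'] [ChartedSpace E' M'] [IsManifold 𝓘(ℝ, E') ∞ M']

theorem differentiableAt_inChart_contraction {k : ℕ} {X : VField E M} {α : DForm E M (k + 1)}
    {x : M} (hα : DifferentiableAt ℝ (α.inChart x) (extChartAt 𝓘(ℝ, E) x x))
    (hX : DifferentiableAt ℝ (X.inChart x) (extChartAt 𝓘(ℝ, E) x x)) :
    DifferentiableAt ℝ ((contraction X α).inChart x) (extChartAt 𝓘(ℝ, E) x x) := by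
  refine (hasFDerivAt_curryLeft hα.hasFDerivAt hX.hasFDerivAt).differentiableAt
    |>.congr_of_eventuallyEq ?_
  filter_upwards [extChartAt_target_mem_nhds (I := 𝓘(ℝ, E)) x] with z hz
    using inChart_contraction X α hz

theorem DForm.d_smul {k : ℕ} (c : ℝ) (α : DForm E M k) : (c • α).d = c • α.d := by
  funext x
  rw [Pi.smul_apply, DForm.d_apply, DForm.d_apply]
  exact extDeriv_smul c (α.inChart x)

variable [FiniteDimensional ℝ E']

/-- Closedness of `i(Φ_* X) Ω'` is checked after pullback by `Φ`, where the form is `c i(X) Ω`. -/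
theorem pushforward_mem_locallyHamiltonian {Ω : DForm E M 2} {Ω' : DForm E' M' 2}
    (hΩ' : IsSymplectic Ω') {Φ : M ≃ₘ⟮𝓘(ℝ, E), 𝓘(ℝ, E')⟯ M'} {c : ℝ}
    (h : DForm.pullback Φ Ω' = c • Ω) {X : VField E M} (hX : X ∈ locallyHamiltonian Ω) :
    VField.pushforward Φ X ∈ locallyHamiltonian Ω' := by
  have : CompleteSpace E' := FiniteDimensional.complete ℝ E'
  have hY := hX.1.pushforward Φ
  refine ⟨hY, funext fun y ↦ ?_⟩
  obtain ⟨x, rfl⟩ : ∃ x, y = Φ x := ⟨_, (Φ.apply_symm_apply y).symm⟩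
  refine (pullback_apply_eq_zero_iff Φ _ x).1 ?_
  rw [← DForm.d_pullback Φ.contMDiff (differentiableAt_inChart_contraction
    (hΩ'.smooth.differentiableAt_inChart _) (hY.differentiableAt_inChart _)),
    ← contraction_pullback, h]
  have h1 : contraction X (c • Ω) = c • contraction X Ω := rfl
  rw [h1, DForm.d_smul, hX.2, smul_zero]
  rfl

variable [FiniteDimensional ℝ E]

theorem isCanonical_of_pullback_eq_smul {Ω : DForm E M 2} (hΩ : IsSymplectic Ω)
    {Ω' : DForm E' M' 2} (hΩ' : IsSymplectic Ω') {Φ : M ≃ₘ⟮𝓘(ℝ, E), 𝓘(ℝ, E')⟯ M'} {c : ℝ}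
    (h : DForm.pullback Φ Ω' = c • Ω) : IsCanonical Ω Ω' Φ := by
  obtain ⟨c', h'⟩ := exists_pullback_symm_eq_smul hΩ' h
  refine Subset.antisymm ?_ fun Y hY ↦ ?_
  · rintro _ ⟨X, hX, rfl⟩
    exact pushforward_mem_locallyHamiltonian hΩ' h hX
  · exact ⟨VField.pushforward Φ.symm Y, pushforward_mem_locallyHamiltonian hΩ h' hY,
      VField.pushforward_pushforward_symm Φ Y⟩

/-- Both `Φ^* Ω'` and `i(X) Φ^* Ω' = Φ^* (i(Φ_* X) Ω')` are closed, so Cartan's formula applies. -/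
theorem IsCanonical.isLHInvariant_pullback {Ω : DForm E M 2} {Ω' : DForm E' M' 2}
    (hΩ' : IsSymplectic Ω') {Φ : M ≃ₘ⟮𝓘(ℝ, E), 𝓘(ℝ, E')⟯ M'} (h : IsCanonical Ω Ω' Φ) :
    IsLHInvariant Ω (DForm.pullback Φ Ω') := by
  intro X hX
  have hY : VField.pushforward Φ X ∈ locallyHamiltonian Ω' := h ▸ mem_image_of_mem _ hX
  funext x
  have hd := hΩ'.smooth.differentiableAt_inChart (Φ x)
  refine lieDeriv_eq_zero_of_closed (DForm.differentiableAt_inChart_pullback Φ.contMDiff hd)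
    (hX.1.differentiableAt_inChart x) ?_ ?_
  · rw [DForm.d_pullback Φ.contMDiff hd, hΩ'.closed]
    rfl
  · rw [contraction_pullback, DForm.d_pullback Φ.contMDiff
      (differentiableAt_inChart_contraction hd (hY.1.differentiableAt_inChart _)), hY.2]
    rfl

end Canonical

end SymplecticGeometry

open SymplecticGeometry in
theorem mainTheorem5
    {E₁ : Type*} [NormedAddCommGroup E₁] [NormedSpace ℝ E₁] [FiniteDimensional ℝ E₁]
    {M₁ : Type*} [TopologicalSpace M₁] [T2Space M₁] [SecondCountableTopology M₁]
    [ChartedSpace E₁ M₁] [IsManifold 𝓘(ℝ, E₁) ∞ M₁]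
    {E₂ : Type*} [NormedAddCommGroup E₂] [NormedSpace ℝ E₂] [FiniteDimensional ℝ E₂]
    {M₂ : Type*} [TopologicalSpace M₂] [T2Space M₂] [SecondCountableTopology M₂]
    [ChartedSpace E₂ M₂] [IsManifold 𝓘(ℝ, E₂) ∞ M₂]
    (Ω₁ : DForm E₁ M₁ 2) (hΩ₁ : IsSymplectic Ω₁)
    (Ω₂ : DForm E₂ M₂ 2) (hΩ₂ : IsSymplectic Ω₂) :
    -- invariant 1-forms vanish
    (∀ α : DForm E₁ M₁ 1, α.IsSmooth → IsLHInvariant Ω₁ α → α = 0) ∧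
    -- invariant 2-forms are constant multiples of the symplectic form
    (ConnectedSpace M₁ → ∀ α : DForm E₁ M₁ 2, α.IsSmooth → IsLHInvariant Ω₁ α →
      ∃ c : ℝ, α = c • Ω₁) ∧
    -- characterization of canonical transformations
    (ConnectedSpace M₁ → ∀ Φ : M₁ ≃ₘ⟮𝓘(ℝ, E₁), 𝓘(ℝ, E₂)⟯ M₂,
      IsCanonical Ω₁ Ω₂ Φ ↔ ∃ c : ℝ, DForm.pullback Φ Ω₂ = c • Ω₁) ∧
    -- one direction does not need connectedness
    (∀ (Φ : M₁ ≃ₘ⟮𝓘(ℝ, E₁), 𝓘(ℝ, E₂)⟯ M₂) (c : ℝ),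
      DForm.pullback Φ Ω₂ = c • Ω₁ → IsCanonical Ω₁ Ω₂ Φ) := by
  refine ⟨fun α _ hα ↦ hα.eq_zero hΩ₁,
    fun _ α hs hα ↦ hα.exists_eq_smul hΩ₁ hs.differentiableAt_inChart,
    fun _ Φ ↦ ⟨fun h ↦ ?_, fun ⟨_, h⟩ ↦ isCanonical_of_pullback_eq_smul hΩ₁ hΩ₂ h⟩,
    fun _ _ h ↦ isCanonical_of_pullback_eq_smul hΩ₁ hΩ₂ h⟩
  exact (h.isLHInvariant_pullback hΩ₂).exists_eq_smul hΩ₁ fun x ↦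
    DForm.differentiableAt_inChart_pullback Φ.contMDiff
      (hΩ₂.smooth.differentiableAt_inChart (Φ x))
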